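/- Let $(M,d)$ be a complete separable metric space with base point $o\in M$. For $x\in M$ let $\xi_x(y)=d(x,o)-d(x,y)$, $y\in M$, and let $\widehat M$ be the closure of $\{\xi_x : x\in M\}$ in the space of continuous functions $M\to\mathbb{R}$ with the topology of uniform convergence on compact sets. The elements of $\widehat M$ are called horofunctions, and the horofunction boundary is the set of horofunctions that are not of the form $\xi_x$ with $x\in M$. Let $(x_n)_{n\in\mathbb{Z}}$ be a random sequence of points of $M$ that is distance stationary, i.e. $(d(x_m,x_n))_{m,n\in\mathbb{Z}}$ and $(d(x_{m+1},x_{n+1}))_{m,n\in\mathbb{Z}}$ have the same distribution, and suppose that $\mathbb{E}[d(x_0,x_1)]<+\infty$. Let $u$ be a random variable that is uniformly distributed on $[0,1]$ and independent of $(x_n)_{n\in\mathbb{Z}}$. For $n\ge 1$ put $\mu_n=\frac1n\sum_{i=1}^n\delta_{\xi_{x_{-i}}}$, a random probability measure on $\widehat M$. Let $\mu$ be a random probability measure on $\widehat M$ that is the almost sure Cesàro limit of a subsequence $(\mu_{n_j})_{j\ge1}$, $n_1<n_2<\cdots$, i.e. almost surely $\frac1k\sum_{j=1}^k\mu_{n_j}\to\mu$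 weakly as $k\to\infty$. Let $\xi$ be a random horofunction that is measurable with respect to $\sigma(u,\mu)$ and whose conditional distribution given $(x_n)_{n\in\mathbb{Z}}$ is $\mu$. If $\mathbb{P}(x_n\in K)\to 0$ as $n\to-\infty$ for every bounded set $K\subset M$, then $\xi$ lies almost surely on the horofunction boundary. -/

import Mathlib

open MeasureTheory ProbabilityTheory Filter Topology
open scoped NNReal

/-- A random sequence `x` indexed by `ℤ` is distance stationary if the array of mutual distances
`d(x_m, x_n)` has the same distribution as the shifted array `d(x_{m+1}, x_{n+1})`. -/
def DistanceStationary {Ω M : Type*} [MeasurableSpace Ω] [MetricSpace M]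
    (P : Measure Ω) (x : ℤ → Ω → M) : Prop :=
  IdentDistrib (fun ω (p : ℤ × ℤ) => dist (x p.1 ω) (x p.2 ω))
    (fun ω (p : ℤ × ℤ) => dist (x (p.1 + 1) ω) (x (p.2 + 1) ω)) P P

/-- The function `y ↦ d(x, o) - d(x, y)` attached to the point `x`, with base point `o`. -/
def pointFunction {M : Type*} [MetricSpace M] (o x : M) : C(M, ℝ) where
  toFun y := dist x o - dist x y
  continuous_toFun := by fun_prop

/-- The horofunction compactification of `M` with base point `o`: the closure of the functions
`pointFunction o x`, `x : M`. The topology of `C(M, ℝ)` in Mathlib is the compact-open topology,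
i.e. that of uniform convergence on compact sets. Elements are called horofunctions. -/
def Horofunction {M : Type*} [MetricSpace M] (o : M) : Type _ :=
  {ξ : C(M, ℝ) // ξ ∈ closure (Set.range (pointFunction o))}

namespace Horofunction

instance instTopologicalSpace {M : Type*} [MetricSpace M] (o : M) :
    TopologicalSpace (Horofunction o) :=
  inferInstanceAs
    (TopologicalSpace {ξ : C(M, ℝ) // ξ ∈ closure (Set.range (pointFunction o))})

instance instMeasurableSpace {M : Type*} [MetricSpace M] (o : M) :
    MeasurableSpace (Horofunction o) :=
  borel (Horofunction o)

instance instBorelSpace {M : Type*} [MetricSpace M] (o : M) : BorelSpace (Horofunction o) :=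
  ⟨rfl⟩

/-- The horofunction `ξ_x` of a point `x`. -/
def ofPoint {M : Type*} [MetricSpace M] (o x : M) : Horofunction o :=
  ⟨pointFunction o x, subset_closure (Set.mem_range_self x)⟩

/-- The horofunction boundary: the horofunctions that are not of the form `ξ_x`. -/
def boundary {M : Type*} [MetricSpace M] (o : M) : Set (Horofunction o) :=
  (Set.range (ofPoint o))ᶜ

/-- For a two-sided sequence of points `x`, the measure `(1/n) ∑_{i=1}^n δ_{ξ_{x_{-i}}}`
on the horofunction compactification (a probability measure when `1 ≤ n`). -/
noncomputable def pastAverage {M : Type*} [MetricSpace M] (o : M) (x : ℤ → M) (n : ℕ) :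
    FiniteMeasure (Horofunction o) :=
  (n : ℝ≥0)⁻¹ • ∑ i ∈ Finset.Icc 1 n, (diracProba (ofPoint o (x (-(i : ℤ))))).toFiniteMeasure

end Horofunction

/-- The sequence `ν 1, ν 2, …` of finite measures is Cesaro convergent to `μ` in the topology of
weak convergence. -/
def CesaroTendsto {X : Type*} [TopologicalSpace X] [MeasurableSpace X] [OpensMeasurableSpace X]
    (ν : ℕ → FiniteMeasure X) (μ : FiniteMeasure X) : Prop :=
  Tendsto (fun k : ℕ => (k : ℝ≥0)⁻¹ • ∑ j ∈ Finset.Icc 1 k, ν j) atTop (𝓝 μ)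

/-- `μ` is the conditional distribution of `ξ` given the σ-algebra `m`: for every measurable set
`s`, the random variable `μ(s)` is a version of the conditional probability of `ξ ∈ s`. -/
def IsCondDistribution {Ω X : Type*} [mΩ : MeasurableSpace Ω] [MeasurableSpace X]
    (P : Measure Ω) (m : MeasurableSpace Ω) (ξ : Ω → X) (μ : Ω → ProbabilityMeasure X) : Prop :=
  ∀ s : Set X, MeasurableSet s → (fun ω => ((μ ω s : ℝ≥0) : ℝ)) =ᵐ[P] P⟦ξ ⁻¹' s | m⟧

/-- `μ` and `ξ` are a random probability and a random horofunction as in the Furstenberg type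
formula for the sequence `x` and the auxiliary random variable `u`: `μ` is the almost sure Cesaro
limit of a subsequence of the random probabilities `(1/n) ∑_{i=1}^n δ_{ξ_{x_{-i}}}`, `n ≥ 1`, and
`ξ` is `σ(u, μ)`-measurable with conditional distribution `μ` given the sequence `x`. Only the
terms `n 1 < n 2 < ⋯` of the index sequence matter, and they are positive. -/
structure IsFurstenbergHorofunction {Ω M : Type*} [MeasurableSpace Ω] [MetricSpace M]
    [MeasurableSpace M] (P : Measure Ω) (o : M) (x : ℤ → Ω → M) (u : Ω → ℝ)
    (μ : Ω → ProbabilityMeasure (Horofunction o)) (ξ : Ω → Horofunction o) : Prop where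
  measurable_limit : Measurable μ
  cesaro : ∃ n : ℕ → ℕ, StrictMono n ∧ ∀ᵐ ω ∂P,
    CesaroTendsto (fun j => Horofunction.pastAverage o (fun i => x i ω) (n j))
      (μ ω).toFiniteMeasure
  measurable_horofunction :
    Measurable[MeasurableSpace.comap (fun ω => (u ω, μ ω)) inferInstance] ξ
  condDistribution :
    IsCondDistribution P (MeasurableSpace.comap (fun ω (i : ℤ) => x i ω) inferInstance) ξ μ

/-! Write S_m = ξ(x_m). The increments of S are stationary: ξ is a limit of uniform choices among
ξ_{x_{-1}}, …, ξ_{x_{-n}}, whose increments along the sequence depend only on mutual distances, and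
shifting time moves the window of indices by one, a negligible change
(`IsFurstenbergHorofunction.integral_along_shift`). Hence the law of R_k = sup_m (S_m - S_k) does
not depend on k (`map_totalRise_succ`). If ξ = ξ_z, then R_k ≤ d(z, x_k) < ∞, while R_k ≥ S_0 - S_k
= d(z, x_k) - d(z, x_0), which escapes to infinity in probability as k → -∞. A fixed law has no
finite mass escaping to infinity (`tendsto_measure_ge_lt_top`), so this event is null. -/

open scoped ENNReal BoundedContinuousFunction

/-! ### Horofunctions evaluated along a sequence -/

namespace Horofunction

variable {M : Type*} [MetricSpace M] {o : M}

/-- The value of a horofunction at a point. -/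
def eval (η : Horofunction o) (y : M) : ℝ := (Subtype.val η : C(M, ℝ)) y

lemma eval_ofPoint (z y : M) : eval (ofPoint o z) y = dist z o - dist z y := rfl

lemma continuous_eval_left (y : M) : Continuous fun η : Horofunction o => eval η y :=
  (continuous_eval_const (F := C(M, ℝ)) y).comp continuous_subtype_val

lemma continuous_eval (η : Horofunction o) : Continuous (eval η) :=
  (Subtype.val η : C(M, ℝ)).continuous

/-- Continuity in the point and measurability in the horofunction suffice since `M` is second
countable; no countable base for the horofunctions is needed. -/
lemma measurable_eval [TopologicalSpace.SeparableSpace M] [MeasurableSpace M] [BorelSpace M] :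
    Measurable fun p : M × Horofunction o => eval p.2 p.1 := by
  have : SecondCountableTopology M := UniformSpace.secondCountable_of_separable M
  exact measurable_uncurry_of_continuous_of_measurable
    (u := fun (y : M) (η : Horofunction o) => eval η y) continuous_eval
    fun y => (continuous_eval_left y).measurable

/-- The values of a horofunction along a two-sided sequence of points. -/
def along (y : ℤ → M) (η : Horofunction o) (m : ℤ) : ℝ := eval η (y m)

lemma continuous_along (y : ℤ → M) : Continuous (along (o := o) y) :=
  continuous_pi fun m => continuous_eval_left (y m)

lemma measurable_along [TopologicalSpace.SeparableSpace M] [MeasurableSpace M] [BorelSpace M] :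
    Measurable fun p : (ℤ → M) × Horofunction o => along p.1 p.2 :=
  measurable_pi_lambda _ fun m => measurable_eval.comp
    (((measurable_pi_apply m).comp measurable_fst).prodMk measurable_snd)

end Horofunction

/-! ### Averages over the past -/

lemma integral_smul_sum_finiteMeasure {X ι : Type*} [TopologicalSpace X] [MeasurableSpace X]
    [OpensMeasurableSpace X] (c : ℝ≥0) (s : Finset ι) (ν : ι → FiniteMeasure X) (g : X →ᵇ ℝ) :
    ∫ η, g η ∂((c • ∑ j ∈ s, ν j : FiniteMeasure X) : Measure X)
      = c * ∑ j ∈ s, ∫ η, g η ∂(ν j : Measure X) := by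
  rw [FiniteMeasure.toMeasure_smul, integral_smul_nnreal_measure, FiniteMeasure.toMeasure_sum,
    integral_finsetSum_measure fun j _ => g.integrable _]
  rfl

lemma Horofunction.integral_pastAverage {M : Type*} [MetricSpace M] (o : M) (y : ℤ → M) (n : ℕ)
    (g : Horofunction o →ᵇ ℝ) :
    ∫ η, g η ∂(pastAverage o y n : Measure (Horofunction o))
      = (n : ℝ)⁻¹ * ∑ i ∈ Finset.Icc 1 n, g (ofPoint o (y (-(i : ℤ)))) := by
  rw [pastAverage, integral_smul_sum_finiteMeasure]
  push_cast
  congr 1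
  refine Finset.sum_congr rfl fun i _ => ?_
  change ∫ η, g η ∂(Measure.dirac _) = _
  exact integral_dirac' _ _ g.continuous.stronglyMeasurable

/-- Averages of a bounded sequence over `{-1, …, -n}` are asymptotically shift invariant. -/
lemma tendsto_average_sub_shift (a : ℤ → ℝ) {C : ℝ} (hC : ∀ i, |a i| ≤ C) {n : ℕ → ℕ}
    (hn : StrictMono n) :
    Tendsto (fun k : ℕ => (k : ℝ)⁻¹ * ∑ j ∈ Finset.Icc 1 k,
      ((n j : ℝ)⁻¹ * ∑ i ∈ Finset.Icc 1 (n j), a (-(i : ℤ) - 1)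
        - (n j : ℝ)⁻¹ * ∑ i ∈ Finset.Icc 1 (n j), a (-(i : ℤ)))) atTop (𝓝 0) := by
  set b : ℕ → ℝ := fun j => (n j : ℝ)⁻¹ * ∑ i ∈ Finset.Icc 1 (n j), a (-(i : ℤ) - 1)
        - (n j : ℝ)⁻¹ * ∑ i ∈ Finset.Icc 1 (n j), a (-(i : ℤ)) with hb
  have htel (m : ℕ) : ∑ i ∈ Finset.Icc 1 m, a (-(i : ℤ) - 1) - ∑ i ∈ Finset.Icc 1 m, a (-(i : ℤ))
      = a (-(m : ℤ) - 1) - a (-1) := by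
    induction m with
    | zero => simp
    | succ m ih =>
      rw [Finset.sum_Icc_succ_top (by omega), Finset.sum_Icc_succ_top (by omega)]
      have : (-((m + 1 : ℕ) : ℤ)) = -(m : ℤ) - 1 := by push_cast; ring
      rw [this]
      linarith
  have hb' : Tendsto b atTop (𝓝 0) := by
    have h1 : Tendsto (fun j => (n j : ℝ)⁻¹ * (2 * C)) atTop (𝓝 0) := by
      simpa using ((tendsto_inv_atTop_zero.comp
        (tendsto_natCast_atTop_atTop (R := ℝ))).comp hn.tendsto_atTop).mul_const (2 * C)
    refine squeeze_zero_norm (fun j => ?_) h1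
    rw [hb]
    simp only
    rw [← mul_sub, htel, norm_mul, Real.norm_of_nonneg (by positivity)]
    refine mul_le_mul_of_nonneg_left ?_ (by positivity)
    rw [Real.norm_eq_abs]
    refine (abs_sub _ _).trans ?_
    linarith [hC (-(n j : ℤ) - 1), hC (-1)]
  -- `cesaro` averages over `range k`; the shift by one matches `Icc 1 k`.
  have := ((tendsto_add_atTop_iff_nat 1).2 hb').cesaro
  refine this.congr fun k => ?_
  rw [Finset.range_eq_Ico, Finset.sum_Ico_add' b 0 k 1]
  congr 1

section JointLaw

variable {Ω X Y : Type*} [mΩ : MeasurableSpace Ω] [MeasurableSpace X] [MeasurableSpace Y]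

/-- Disintegration of the joint law of `(x, ξ)` when `μ` is the conditional distribution of `ξ`
given `x`. -/
lemma IsCondDistribution.integral_prodMk {P : Measure Ω} [IsProbabilityMeasure P] {x : Ω → Y}
    (hx : Measurable x) {ξ : Ω → X} (hξ : Measurable ξ) {μ : Ω → ProbabilityMeasure X}
    (hμ : Measurable μ)
    (h : IsCondDistribution P (MeasurableSpace.comap x inferInstance) ξ μ)
    {G : Y × X → ℝ} (hG : Measurable G) {C : ℝ} (hC : ∀ p, |G p| ≤ C) :
    ∫ ω, G (x ω, ξ ω) ∂P = ∫ ω, ∫ η, G (x ω, η) ∂(μ ω : Measure X) ∂P := by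
  let κ : Kernel Ω X := ⟨fun ω => (μ ω : Measure X), measurable_subtype_coe.comp hμ⟩
  have : IsMarkovKernel κ := ⟨fun ω => (μ ω).2⟩
  have hmap : Measurable (Prod.map x id : Ω × X → Y × X) := hx.prodMap measurable_id
  have hle : MeasurableSpace.comap x inferInstance ≤ mΩ := hx.comap_le
  have key : P.map (fun ω => (x ω, ξ ω)) = (P ⊗ₘ κ).map (Prod.map x id) := by
    have : IsProbabilityMeasure (P.map fun ω => (x ω, ξ ω)) :=
      Measure.isProbabilityMeasure_map (hx.prodMk hξ).aemeasurable
    refine Measure.ext_prod fun {s t} hs ht => ?_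
    rw [Measure.map_apply (hx.prodMk hξ) (hs.prod ht), Measure.map_apply hmap (hs.prod ht)]
    have e1 : (Prod.map x id : Ω × X → Y × X) ⁻¹' (s ×ˢ t) = (x ⁻¹' s) ×ˢ t := rfl
    have e2 : (fun ω => (x ω, ξ ω)) ⁻¹' (s ×ˢ t) = ξ ⁻¹' t ∩ x ⁻¹' s := by
      ext; simp [and_comm]
    rw [e1, e2, Measure.compProd_apply_prod (hx hs) ht]
    -- The defining property of conditional expectation on the σ(x)-measurable set `x ⁻¹' s`.
    have hi : ∫ ω in x ⁻¹' s, ((μ ω t : ℝ≥0) : ℝ) ∂P = P.real (ξ ⁻¹' t ∩ x ⁻¹' s) := by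
      rw [setIntegral_congr_ae (hx hs) ((h t ht).mono fun ω hω _ => hω),
        setIntegral_condExp hle ((integrable_const (1 : ℝ)).indicator (hξ ht)) ⟨s, hs, rfl⟩,
        integral_indicator (hξ ht), Measure.restrict_restrict (hξ ht)]
      simp
    have hm : Measurable fun ω => κ ω t := κ.measurable_coe ht
    have hi' : ∫ ω in x ⁻¹' s, ((μ ω t : ℝ≥0) : ℝ) ∂P = (∫⁻ ω in x ⁻¹' s, κ ω t ∂P).toReal := by
      rw [← integral_toReal hm.aemeasurable (ae_of_all _ fun ω => measure_lt_top _ _)]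
      rfl
    rw [hi', Measure.real] at hi
    refine ((ENNReal.toReal_eq_toReal_iff' ?_ (measure_ne_top _ _)).1 hi).symm
    refine ((lintegral_mono fun ω => prob_le_one).trans_lt ?_).ne
    simp
  have hGi : Integrable (fun p : Ω × X => G (x p.1, p.2)) (P ⊗ₘ κ) :=
    (integrable_const C).mono' (hG.comp hmap).aestronglyMeasurable (ae_of_all _ fun p => hC _)
  calc ∫ ω, G (x ω, ξ ω) ∂P = ∫ p, G p ∂(P.map fun ω => (x ω, ξ ω)) :=
        (integral_map (hx.prodMk hξ).aemeasurable hG.aestronglyMeasurable).symm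
    _ = ∫ p, G (x p.1, p.2) ∂(P ⊗ₘ κ) := by
        rw [key, integral_map hmap.aemeasurable hG.aestronglyMeasurable]
        rfl
    _ = _ := Measure.integral_compProd hGi

end JointLaw

/-! ### Stationarity of the increments -/

lemma DistanceStationary.integral_shift {Ω M : Type*} [MeasurableSpace Ω] {P : Measure Ω}
    [MetricSpace M] {x : ℤ → Ω → M} (hstat : DistanceStationary P x)
    (F : (ℤ → ℝ) →ᵇ ℝ) (i : ℤ) :
    ∫ ω, F (fun m => -dist (x i ω) (x (m + 1) ω)) ∂P
      = ∫ ω, F (fun m => -dist (x (i - 1) ω) (x m ω)) ∂P := by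
  have hφ : Measurable fun D : ℤ × ℤ → ℝ => F fun m => -D (i - 1, m) :=
    F.continuous.measurable.comp <| measurable_pi_lambda _ fun m => (measurable_pi_apply _).neg
  have := (hstat.comp hφ).integral_eq
  simp only [Function.comp_def, sub_add_cancel] at this
  exact this.symm

open Horofunction in
/-- Bounded continuous functionals of the increments of the random horofunction along the sequence
have shift invariant expectation. -/
lemma IsFurstenbergHorofunction.integral_along_shift {Ω M : Type*} [mΩ : MeasurableSpace Ω]
    {P : Measure Ω} [IsProbabilityMeasure P] [MetricSpace M] [TopologicalSpace.SeparableSpace M]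
    [MeasurableSpace M] [BorelSpace M] {o : M} {x : ℤ → Ω → M} (hx : ∀ n, Measurable (x n))
    (hstat : DistanceStationary P x) {u : Ω → ℝ}
    {μ : Ω → ProbabilityMeasure (Horofunction o)} {ξ : Ω → Horofunction o}
    (hξ : IsFurstenbergHorofunction P o x u μ ξ) (hξm : Measurable ξ)
    (F : (ℤ → ℝ) →ᵇ ℝ) (hF : ∀ (S : ℤ → ℝ) (c : ℝ), F (fun m => c + S m) = F S) :
    ∫ ω, F (fun m => along (fun i => x i ω) (ξ ω) (m + 1)) ∂P
      = ∫ ω, F (along (fun i => x i ω) (ξ ω)) ∂P := by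
  have hxm : Measurable fun ω (i : ℤ) => x i ω := measurable_pi_lambda _ hx
  obtain ⟨n, hn, hces⟩ := hξ.cesaro
  have hC (S : ℤ → ℝ) : |F S| ≤ ‖F‖ := F.norm_coe_le_norm S
  -- Only `s = 0` and `s = 1` are used. Invariance of `F` under constants removes the base-point
  -- term d(x_{-i}, o), leaving a functional of mutual distances.
  have lim (s : ℤ) : Tendsto (fun k : ℕ => (k : ℝ)⁻¹ * ∑ j ∈ Finset.Icc 1 k, (n j : ℝ)⁻¹ *
      ∑ i ∈ Finset.Icc 1 (n j), ∫ ω, F (fun m => -dist (x (-(i : ℤ)) ω) (x (m + s) ω)) ∂P) atTop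
      (𝓝 (∫ ω, F (fun m => along (fun i => x i ω) (ξ ω) (m + s)) ∂P)) := by
    have hshift : Continuous fun S : ℤ → ℝ => fun m => S (m + s) :=
      continuous_pi fun m => continuous_apply _
    have hFs : Continuous fun S : ℤ → ℝ => F fun m => S (m + s) := F.continuous.comp hshift
    have hG := hFs.measurable.comp (measurable_along (o := o))
    rw [hξ.condDistribution.integral_prodMk hxm hξm hξ.measurable_limit
      (G := fun p => F fun m => along p.1 p.2 (m + s)) hG fun p => hC _]
    have hterm (i : ℕ) :
        Measurable fun ω => F fun m => -dist (x (-(i : ℤ)) ω) (x (m + s) ω) :=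
      F.continuous.measurable.comp <| measurable_pi_lambda _ fun m =>
        ((hx _).dist (hx _)).neg
    have hint (i : ℕ) :
        Integrable (fun ω => F fun m => -dist (x (-(i : ℤ)) ω) (x (m + s) ω)) P :=
      (integrable_const ‖F‖).mono' (hterm i).aestronglyMeasurable (ae_of_all _ fun ω => hC _)
    have hsum (k : ℕ) : (k : ℝ)⁻¹ * ∑ j ∈ Finset.Icc 1 k, (n j : ℝ)⁻¹ *
          ∑ i ∈ Finset.Icc 1 (n j), ∫ ω, F (fun m => -dist (x (-(i : ℤ)) ω) (x (m + s) ω)) ∂P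
        = ∫ ω, (k : ℝ)⁻¹ * ∑ j ∈ Finset.Icc 1 k, (n j : ℝ)⁻¹ *
          ∑ i ∈ Finset.Icc 1 (n j), F (fun m => -dist (x (-(i : ℤ)) ω) (x (m + s) ω)) ∂P := by
      rw [integral_const_mul, integral_finsetSum _ fun j _ =>
        (integrable_finsetSum _ fun i _ => hint i).const_mul _]
      simp_rw [integral_const_mul, integral_finsetSum _ fun i _ => hint i]
    simp_rw [hsum]
    refine tendsto_integral_of_dominated_convergence (fun _ => ‖F‖) (fun k => ?_)
      (integrable_const _) (fun k => ae_of_all _ fun ω => ?_) ?_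
    · exact (Measurable.const_mul (Finset.measurable_fun_sum _ fun j _ =>
        (Finset.measurable_fun_sum _ fun i _ => hterm i).const_mul _) _).aestronglyMeasurable
    · have avg (K : ℕ) (b : ℕ → ℝ) (hb : ∀ j, |b j| ≤ ‖F‖) :
          |(K : ℝ)⁻¹ * ∑ j ∈ Finset.Icc 1 K, b j| ≤ ‖F‖ := by
        rw [abs_mul, abs_of_nonneg (by positivity)]
        have : |∑ j ∈ Finset.Icc 1 K, b j| ≤ K * ‖F‖ := by
          refine (Finset.abs_sum_le_sum_abs _ _).trans ((Finset.sum_le_sum fun j _ => hb j).trans ?_)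
          simp
        rcases Nat.eq_zero_or_pos K with rfl | hK
        · simp
        · rw [inv_mul_le_iff₀ (by exact_mod_cast hK)]
          exact this
      exact avg _ _ fun j => avg _ _ fun i => hC _
    · filter_upwards [hces] with ω hω
      let g : Horofunction o →ᵇ ℝ := BoundedContinuousFunction.ofNormedAddCommGroup
        (fun η => F fun m => along (fun i => x i ω) η (m + s))
        (hFs.comp (continuous_along _)) ‖F‖ fun η => hC _
      have h := FiniteMeasure.tendsto_iff_forall_integral_tendsto.1 hω g
      simp_rw [integral_smul_sum_finiteMeasure, integral_pastAverage] at h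
      have hg (i : ℕ) : g (ofPoint o (x (-(i : ℤ)) ω))
          = F (fun m => -dist (x (-(i : ℤ)) ω) (x (m + s) ω)) := by
        rw [← hF _ (dist (x (-(i : ℤ)) ω) o)]
        rfl
      simp_rw [hg] at h
      exact h
  have h0 := lim 0
  have h1 := lim 1
  -- Stationarity trades the time shift for a shift of the index -i to -i - 1.
  simp_rw [hstat.integral_shift] at h1
  simp only [add_zero] at h0
  have hd := h1.sub h0
  have hz := tendsto_average_sub_shift
    (fun i => ∫ ω, F (fun m => -dist (x i ω) (x m ω)) ∂P) (C := ‖F‖) (fun i => by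
      simpa using norm_integral_le_of_norm_le_const (μ := P) (f := fun ω =>
        F (fun m => -dist (x i ω) (x m ω))) (ae_of_all _ fun ω => hC _)) hn
  refine sub_eq_zero.1 (tendsto_nhds_unique hd (hz.congr fun k => ?_))
  rw [Finset.sum_sub_distrib, mul_sub]

/-! ### The total rise and its law -/

/-- The largest increment of `S` from time `k` to a time in `{k - N, …, k + N}`. -/
noncomputable def windowRise (k : ℤ) (N : ℕ) (S : ℤ → ℝ) : ℝ≥0∞ :=
  (Finset.Icc (-(N : ℤ)) N).sup fun j => ENNReal.ofReal (S (k + j) - S k)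

/-- The supremum of the increments of `S` from time `k`. -/
noncomputable def totalRise (k : ℤ) (S : ℤ → ℝ) : ℝ≥0∞ := ⨆ N, windowRise k N S

lemma continuous_windowRise (k : ℤ) (N : ℕ) : Continuous (windowRise k N) :=
  Continuous.finset_sup_apply fun j _ => ENNReal.continuous_ofReal.comp
    ((continuous_apply (k + j)).sub (continuous_apply k))

lemma measurable_totalRise (k : ℤ) : Measurable (totalRise k) :=
  .iSup fun N => (continuous_windowRise k N).measurable

lemma tendsto_windowRise (k : ℤ) (S : ℤ → ℝ) :
    Tendsto (fun N => windowRise k N S) atTop (𝓝 (totalRise k S)) :=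
  tendsto_atTop_iSup fun a b hab => Finset.sup_mono (Finset.Icc_subset_Icc (by omega) (by omega))

lemma totalRise_le {k : ℤ} {S : ℤ → ℝ} {B : ℝ} (h : ∀ m, S m - S k ≤ B) :
    totalRise k S ≤ ENNReal.ofReal B :=
  iSup_le fun _ => Finset.sup_le fun _ _ => ENNReal.ofReal_le_ofReal (h _)

lemma le_totalRise (k m : ℤ) (S : ℤ → ℝ) : ENNReal.ofReal (S m - S k) ≤ totalRise k S := by
  have hm : m - k ∈ Finset.Icc (-((m - k).natAbs : ℤ)) ((m - k).natAbs) := by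
    rw [Finset.mem_Icc]; omega
  refine le_trans ?_ (le_iSup (fun N => windowRise k N S) (m - k).natAbs)
  refine le_trans (le_of_eq ?_) (Finset.le_sup hm)
  rw [add_sub_cancel]

/-- If bounded continuous functionals of the increments have shift invariant expectation, then the
law of the total rise from time `k` does not depend on `k`. -/
lemma map_totalRise_succ {Ω : Type*} [MeasurableSpace Ω] {P : Measure Ω} [IsProbabilityMeasure P]
    {S : Ω → ℤ → ℝ} (hS : Measurable S)
    (h : ∀ F : (ℤ → ℝ) →ᵇ ℝ, (∀ (T : ℤ → ℝ) (c : ℝ), F (fun m => c + T m) = F T) →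
      ∫ ω, F (fun m => S ω (m + 1)) ∂P = ∫ ω, F (S ω) ∂P) (k : ℤ) :
    P.map (fun ω => totalRise (k + 1) (S ω)) = P.map fun ω => totalRise k (S ω) := by
  have hm (k : ℤ) : Measurable fun ω => totalRise k (S ω) := (measurable_totalRise k).comp hS
  have (k : ℤ) : IsProbabilityMeasure (P.map fun ω => totalRise k (S ω)) :=
    Measure.isProbabilityMeasure_map (hm k).aemeasurable
  refine ext_of_forall_integral_eq_of_IsFiniteMeasure fun f => ?_
  rw [integral_map (hm _).aemeasurable f.continuous.measurable.aestronglyMeasurable,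
    integral_map (hm _).aemeasurable f.continuous.measurable.aestronglyMeasurable]
  -- The total rise is a supremum of continuous functions and need not be continuous, so invariance
  -- is applied to finite windows, then N → ∞.
  have lim (k : ℤ) : Tendsto (fun N => ∫ ω, f (windowRise k N (S ω)) ∂P) atTop
      (𝓝 (∫ ω, f (totalRise k (S ω)) ∂P)) :=
    tendsto_integral_of_dominated_convergence (fun _ => ‖f‖)
      (fun N => ((f.continuous.comp (continuous_windowRise k N)).measurable.comp
        hS).aestronglyMeasurable) (integrable_const _)
      (fun N => ae_of_all _ fun ω => f.norm_coe_le_norm _)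
      (ae_of_all _ fun ω => (f.continuous.tendsto _).comp (tendsto_windowRise k _))
  refine tendsto_nhds_unique (lim (k + 1)) ((lim k).congr fun N => ?_)
  have := h (f.compContinuous ⟨_, continuous_windowRise k N⟩) fun T c => by
    simp [windowRise]
  simp only [BoundedContinuousFunction.compContinuous_apply, ContinuousMap.coe_mk] at this
  rw [← this]
  simp only [windowRise, add_right_comm]

/-- These events decrease to the empty set; the value ∞, which may have positive probability, is
excluded. -/
lemma tendsto_measure_ge_lt_top {Ω : Type*} [MeasurableSpace Ω] {P : Measure Ω}
    [IsFiniteMeasure P] {f : Ω → ℝ≥0∞} (hf : Measurable f) :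
    Tendsto (fun T : ℕ => P {ω | (T : ℝ≥0∞) ≤ f ω ∧ f ω < ∞}) atTop (𝓝 0) := by
  have hms (T : ℕ) : MeasurableSet {ω | (T : ℝ≥0∞) ≤ f ω ∧ f ω < ∞} :=
    (measurableSet_le measurable_const hf).inter (measurableSet_lt hf measurable_const)
  have := tendsto_measure_iInter_atTop (μ := P)
    (s := fun T : ℕ => {ω | (T : ℝ≥0∞) ≤ f ω ∧ f ω < ∞}) (fun T => (hms T).nullMeasurableSet)
    (fun a b hab ω hω => ⟨le_trans (by exact_mod_cast hab) hω.1, hω.2⟩) ⟨0, measure_ne_top _ _⟩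
  have hemp : ⋂ T : ℕ, {ω | (T : ℝ≥0∞) ≤ f ω ∧ f ω < ∞} = ∅ := by
    refine Set.eq_empty_of_forall_notMem fun ω hω => ?_
    rw [Set.mem_iInter] at hω
    obtain ⟨T, hT⟩ := ENNReal.exists_nat_gt (hω 0).2.ne
    exact absurd (hω T).1 hT.not_ge
  rwa [hemp, measure_empty] at this

/-! ### Escape of the sequence against stationarity -/

theorem proposition3p2 {Ω M : Type*} [MeasurableSpace Ω] (P : Measure Ω) [IsProbabilityMeasure P]
    [MetricSpace M] [CompleteSpace M] [TopologicalSpace.SeparableSpace M]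
    [MeasurableSpace M] [BorelSpace M] (o : M)
    (x : ℤ → Ω → M) (hx : ∀ n, Measurable (x n))
    (hstat : DistanceStationary P x)
    (hint : Integrable (fun ω => dist (x 0 ω) (x 1 ω)) P)
    (u : Ω → ℝ) (hu : Measurable u)
    (hu_unif : P.map u = (volume : Measure ℝ).restrict (Set.Icc 0 1))
    (hu_indep : IndepFun u (fun ω (n : ℤ) => x n ω) P)
    (hescape : ∀ K : Set M, Bornology.IsBounded K →
      Tendsto (fun n : ℤ => P (x n ⁻¹' K)) atBot (𝓝 0))
    (μ : Ω → ProbabilityMeasure (Horofunction o)) (ξ : Ω → Horofunction o)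
    (hξ : IsFurstenbergHorofunction P o x u μ ξ) :
    ∀ᵐ ω ∂P, ξ ω ∈ Horofunction.boundary o := by
  have hξm : Measurable ξ := hξ.measurable_horofunction.mono
    (hu.prodMk hξ.measurable_limit).comap_le le_rfl
  set S : Ω → ℤ → ℝ := fun ω => Horofunction.along (fun i => x i ω) (ξ ω) with hSdef
  have hS : Measurable S := Horofunction.measurable_along.comp
    ((measurable_pi_lambda _ hx).prodMk hξm)
  have hm (k : ℤ) : Measurable fun ω => totalRise k (S ω) := (measurable_totalRise k).comp hS
  have hlaw (k : ℕ) :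
      P.map (fun ω => totalRise (-(k : ℤ)) (S ω)) = P.map fun ω => totalRise 0 (S ω) := by
    induction k with
    | zero => simp
    | succ k ih =>
      have := map_totalRise_succ hS (fun F hF => hξ.integral_along_shift hx hstat hξm F hF)
        (-((k + 1 : ℕ) : ℤ))
      rw [← this, ← ih]
      push_cast
      simp
  -- Bounding d(z, o) and d(z, x_0) by L makes the escape uniform in z; countably many L cover all
  -- cases.
  have hbound (L : ℕ) :
      P {ω | ∃ z, ξ ω = Horofunction.ofPoint o z ∧ dist z o ≤ L ∧ dist z (x 0 ω) ≤ L} = 0 := by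
    refine le_antisymm (ge_of_tendsto' (tendsto_measure_ge_lt_top (P := P) (hm 0)) fun T => ?_)
      zero_le
    have hesc : Tendsto (fun k : ℕ =>
        P (x (-(k : ℤ)) ⁻¹' Metric.closedBall o (T + 2 * L))) atTop (𝓝 0) :=
      (hescape _ Metric.isBounded_closedBall).comp
        (tendsto_neg_atTop_atBot.comp tendsto_natCast_atTop_atTop)
    have hlim := hesc.add_const (P {ω | (T : ℝ≥0∞) ≤ totalRise 0 (S ω) ∧ totalRise 0 (S ω) < ∞})
    rw [zero_add] at hlim
    refine ge_of_tendsto' hlim fun k => ?_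
    have hB : MeasurableSet {t : ℝ≥0∞ | (T : ℝ≥0∞) ≤ t ∧ t < ∞} := measurableSet_Ico
    have heq : P {ω | (T : ℝ≥0∞) ≤ totalRise 0 (S ω) ∧ totalRise 0 (S ω) < ∞}
        = P {ω | (T : ℝ≥0∞) ≤ totalRise (-(k : ℤ)) (S ω) ∧ totalRise (-(k : ℤ)) (S ω) < ∞} := by
      have := congrArg (fun ν : Measure ℝ≥0∞ => ν {t | (T : ℝ≥0∞) ≤ t ∧ t < ∞}) (hlaw k)
      simp only [Measure.map_apply (hm _) hB] at this
      exact this.symm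
    rw [heq]
    -- Only monotonicity and subadditivity are used, so the event on the left need not be
    -- measurable.
    refine (measure_mono ?_).trans (measure_union_le _ _)
    rintro ω ⟨z, hz, hzo, hz0⟩
    have hSω (m : ℤ) : S ω m = dist z o - dist z (x m ω) := by
      simp only [hSdef, Horofunction.along, hz, Horofunction.eval_ofPoint]
    -- In T + 2L, one L pays for d(z, o) and the other for d(z, x_0): outside the ball S_0 - S_{-k}
    -- > T.
    by_cases hk : x (-(k : ℤ)) ω ∈ Metric.closedBall o (T + 2 * L : ℝ)
    · exact Or.inl hk
    right
    refine ⟨?_, (totalRise_le (B := dist z (x (-(k : ℤ)) ω)) fun m => ?_).trans_lt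
      ENNReal.ofReal_lt_top⟩
    · refine le_trans ?_ (le_totalRise _ 0 _)
      rw [← ENNReal.ofReal_natCast]
      refine ENNReal.ofReal_le_ofReal ?_
      rw [Metric.mem_closedBall, not_le] at hk
      have := dist_triangle_left (x (-(k : ℤ)) ω) o z
      rw [hSω, hSω]
      linarith
    · rw [hSω, hSω]
      linarith [dist_nonneg (x := z) (y := x m ω)]
  have hunion := measure_iUnion_null hbound
  rw [ae_iff]
  refine measure_mono_null (fun ω hω => ?_) hunion
  obtain ⟨z, hz⟩ := not_not.1 hω
  obtain ⟨L, hL⟩ := exists_nat_ge (max (dist z o) (dist z (x 0 ω)))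
  exact Set.mem_iUnion.2 ⟨L, z, hz.symm, (le_max_left _ _).trans hL, (le_max_right _ _).trans hL⟩
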